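/- Let $(\mathcal S,d)$ be a complete metric space, and let $\phi:\mathcal S\to(-\infty,+\infty]$ and $g:\mathcal S\to[0,+\infty]$ be lower semicontinuous. Suppose that $\phi$ is quadratically bounded from below, i.e. there are $A,B>0$ and $x_\star\in\mathcal S$ with $\phi(x)\ge -A-B\,d^2(x,x_\star)$ for all $x\in\mathcal S$. A curve $v:[0,+\infty)\to\mathcal S$ is locally absolutely continuous if there is a function $m$, integrable on $(0,T)$ for every $T>0$, with $d(v(s),v(t))\le\int_s^t m(r)\,dr$ for all $0\le s\le t<+\infty$; then its metric derivative $|v'|(t)=\lim_{s\to t}\frac{d(v(s),v(t))}{|s-t|}$ exists for a.e. $t$. Suppose that $g$ is a strong upper gradient for $\phi$: for every locally absolutely continuous $v:[0,+\infty)\to\mathcal S$ the function $g\circ v$ is Borel and $$|\phi(v(t))-\phi(v(s))|\le\int_s^t g(v(r))\,|v'|(r)\,dr\qquad\text{for all }0\le s\le t<+\infty$$ (nothing being required when $\phi(v(s))=\phi(v(t))=+\infty$). Let $\mathcal U(\phi,g)$ be the set of all locally absolutely continuous curves $u:[0,+\infty)\to\mathcal S$ with $\phi(u(0))<+\infty$,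 $g\circ u$ Borel, and $$\phi(u(s))-\phi(u(t))\ \ge\ \frac12\int_s^t g^2(u(r))\,dr+\frac12\int_s^t|u'|^2(r)\,dr\qquad\text{for all }0\le s\le t<+\infty .$$ For a curve $u$ let $\mathcal R[u]=u([0,+\infty))$, let $\overline{\mathcal R[u]}$ be the union of $\mathcal R[u]$ with the set of all limits of sequences $u(t_n)$ with $t_n\to+\infty$, and let $T_\star(u)=\inf\{s\ge0: u(t)=u(s)\text{ for all }t\ge s\}\in[0,+\infty]$. For $u,v\in\mathcal U(\phi,g)$ write $u\succ v$ if $\mathcal R[v]\subset\overline{\mathcal R[u]}$ and there is a nondecreasing $1$-Lipschitz map $\mathsf z:[0,+\infty)\to[0,+\infty)$ with $\mathsf z(0)=0$ and $u(t)=v(\mathsf z(t))$ for all $t\ge0$. A curve $u\in\mathcal U(\phi,g)$ is minimal if $u\succ v$ with $v\in\mathcal U(\phi,g)$ implies $u=v$. Then, for every $u\in\mathcal U(\phi,g)$, the curve $u$ is minimal if and only if $$\mathcal L^1\big(\{t\in[0,T_\star(u)) : g(u(t))=0\}\big)=0 .$$ -/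

import Mathlib

open MeasureTheory Filter Topology
open scoped NNReal ENNReal

noncomputable section

namespace MinimalGradientFlow

variable {S : Type*}

/-! Curves `[0,∞) → S` are functions `ℝ≥0 → S`. Integrals in time are taken over subintervals
`[s,t] ⊆ [0,∞)` of the real line with Lebesgue measure; there `r.toNNReal` is just `r`. -/

/-- `v ∈ AC_loc([0,∞); S)`: there is a function `m`, integrable on every interval `[0,T]`, such that
`d(v(s), v(t)) ≤ ∫_s^t m(r) dr` for all `0 ≤ s ≤ t`. -/
def LocallyAbsCont [MetricSpace S] (v : ℝ≥0 → S) : Prop :=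
  ∃ m : ℝ → ℝ, (∀ T : ℝ, IntegrableOn m (Set.Icc 0 T) volume) ∧
    ∀ s t : ℝ≥0, s ≤ t → dist (v s) (v t) ≤ ∫ r in Set.Icc (s : ℝ) t, m r

/-- The metric derivative `|v'|(t) = lim_{s → t} d(v(s), v(t)) / |s - t|`. It is written as an
upper limit with values in `[0,∞]`, so that it is defined for every `t`; wherever the limit
exists (for locally absolutely continuous curves: at almost every `t`) it is this limit, see
`metricDeriv_eq_of_tendsto`. -/
def metricDeriv [MetricSpace S] (v : ℝ≥0 → S) (t : ℝ≥0) : ℝ≥0∞ :=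
  limsup (fun s : ℝ≥0 => edist (v s) (v t) / edist s t) (𝓝[≠] t)

theorem neBot_nhdsWithin_ne (t : ℝ≥0) : (𝓝[≠] t).NeBot :=
  (inferInstance : (𝓝[>] t).NeBot).mono
    (nhdsWithin_mono t fun _ hs => ne_of_gt hs)

theorem metricDeriv_eq_of_tendsto [MetricSpace S] {v : ℝ≥0 → S} {t : ℝ≥0} {L : ℝ≥0∞}
    (h : Tendsto (fun s : ℝ≥0 => edist (v s) (v t) / edist s t) (𝓝[≠] t) (𝓝 L)) :
    metricDeriv v t = L :=
  haveI := neBot_nhdsWithin_ne t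
  h.limsup_eq

/-- `g : S → [0,∞]` is a strong upper gradient for `φ : S → (-∞,∞]`: for every locally absolutely
continuous curve `v`, the function `g ∘ v` is Borel and
`|φ(v(t)) - φ(v(s))| ≤ ∫_s^t g(v(r)) |v'|(r) dr` for all `0 ≤ s ≤ t`.
The bound on the absolute value is written as two one-sided bounds, so that no difference
`∞ - ∞` occurs: if exactly one of the two values of `φ` is `∞`, then the integral has to be `∞`,
and if both are `∞`, nothing is required. -/
def IsStrongUpperGradient [MetricSpace S] (φ : S → EReal) (g : S → ℝ≥0∞) : Prop :=
  ∀ v : ℝ≥0 → S, LocallyAbsCont v →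
    Measurable (fun r => g (v r)) ∧
    ∀ s t : ℝ≥0, s ≤ t →
      φ (v t) ≤ φ (v s) +
        ((∫⁻ r in Set.Icc (s : ℝ) t, g (v r.toNNReal) * metricDeriv v r.toNNReal : ℝ≥0∞) : EReal) ∧
      φ (v s) ≤ φ (v t) +
        ((∫⁻ r in Set.Icc (s : ℝ) t, g (v r.toNNReal) * metricDeriv v r.toNNReal : ℝ≥0∞) : EReal)

/-- The family `𝒰(φ, g)` of all locally absolutely continuous curves `u` with `φ(u(0)) < ∞`
(and `g ∘ u` Borel) that satisfy the energy dissipation inequality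
`φ(u(s)) - φ(u(t)) ≥ ½ ∫_s^t g²(u(r)) dr + ½ ∫_s^t |u'|²(r) dr` for all `0 ≤ s ≤ t`. -/
def solutions [MetricSpace S] (φ : S → EReal) (g : S → ℝ≥0∞) : Set (ℝ≥0 → S) :=
  {u | LocallyAbsCont u ∧ Measurable (fun r => g (u r)) ∧ φ (u 0) < ⊤ ∧
    ∀ s t : ℝ≥0, s ≤ t →
      (((2 : ℝ≥0∞)⁻¹ * (∫⁻ r in Set.Icc (s : ℝ) t, g (u r.toNNReal) ^ 2) +
        (2 : ℝ≥0∞)⁻¹ * (∫⁻ r in Set.Icc (s : ℝ) t, metricDeriv u r.toNNReal ^ 2) : ℝ≥0∞) : EReal)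
        ≤ φ (u s) - φ (u t)}

/-- The range of `u` together with its `ω`-limit set, i.e. with all limits of `u(t_n)` along
sequences of times `t_n → ∞`. -/
def extendedRange [TopologicalSpace S] (u : ℝ≥0 → S) : Set S :=
  Set.range u ∪
    {w | ∃ τ : ℕ → ℝ≥0, Tendsto τ atTop atTop ∧ Tendsto (fun n => u (τ n)) atTop (𝓝 w)}

/-- The relation `u ≻ v`: the range of `v` is contained in the extended range of `u`, and `u` is
obtained from `v` by an increasing (in the wide sense) `1`-Lipschitz change of time `z` with
`z(0) = 0`. -/
def Succ [TopologicalSpace S] (u v : ℝ≥0 → S) : Prop :=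
  Set.range v ⊆ extendedRange u ∧
    ∃ z : ℝ≥0 → ℝ≥0, Monotone z ∧ LipschitzWith 1 z ∧ z 0 = 0 ∧ ∀ t, u t = v (z t)

/-- `u` is a minimal element of the family `U` of curves. -/
def IsMinimal [TopologicalSpace S] (U : Set (ℝ≥0 → S)) (u : ℝ≥0 → S) : Prop :=
  u ∈ U ∧ ∀ v ∈ U, Succ u v → u = v

/-- `T⋆(u) = inf {s ≥ 0 | u(t) = u(s) for all t ≥ s} ∈ [0,∞]`, with `inf ∅ = ∞`. -/
def Tstar (u : ℝ≥0 → S) : ℝ≥0∞ :=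
  sInf {a : ℝ≥0∞ | ∃ s : ℝ≥0, a = s ∧ ∀ t : ℝ≥0, s ≤ t → u t = u s}

end MinimalGradientFlow

end

/-!
Let `u ∈ 𝒰(φ, g)`. The dissipation inequality and the strong upper gradient property squeeze
`φ(u(s)) - φ(u(t))` between `½ ∫ g²(u) + ½ ∫ |u'|²` and `∫ g(u) |u'|`, so equality holds in Young's
inequality: `g(u) = |u'|` almost everywhere, `φ(u(s)) - φ(u(t)) = ∫ g²(u)`
(`energy_identity_and_ae_eq`) and `d(u(s), u(t)) ≤ ∫ g(u)`. The only other general tool is the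
change of variables `∫ f(z(t)) z'(t) dt = ∫ f(r) dr` for monotone `1`-Lipschitz `z`
(`lintegral_image_eq_of_monotone_of_lipschitz`).

If `u = v ∘ z` with `v ∈ 𝒰(φ, g)`, both curves dissipate the same energy, hence
`∫ g²(u) (1 - z') = 0` and `z' = 1` almost everywhere where `g(u) > 0`. If `u` spends no time in
`{g = 0}` before `T⋆(u)`, then `z` is the identity on `[0, T⋆(u)]`. After a finite `T⋆(u)` the curve
`v` has to stay in the range of `u` without raising its energy, which leaves only the point
`u(T⋆)`. Hence `u = v` (`isMinimal_of_volume_eq_zero`).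

Conversely, every `u` can be run in its active time `Z(t) = ℒ¹({r ≤ t | g(u(r)) ≠ 0})`. Since
`|u'| = 0` almost everywhere on `{g(u) = 0}`, the relation `v(Z(t)) = u(t)` defines a curve `v` on
the range of `Z`. If `Z` is bounded, the Cauchy–Schwarz inequality
`d²(u(s), u(t)) ≤ (Z(t) - Z(s)) (φ(u(s)) - φ(u(t)))` and the quadratic lower bound keep `φ ∘ u`
bounded from below, so that `u(t)` converges to some `w`, with `g(w) = 0` and `φ(w) ≤ φ(u(t))` by
lower semicontinuity (`exists_limit_of_bounded_activeTime`), and `v` is extended by `w`. This `v`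
belongs to `𝒰(φ, g)`, satisfies `u ≻ v`, and spends no time in `{g = 0}` before `T⋆(v)`. If `u` is
minimal, then `u = v`, so `u` has the same property.
-/

/-! ### The metric derivative -/

namespace MinimalGradientFlow

theorem locallyIntegrable_indicator_Ici {m : ℝ → ℝ}
    (hm : ∀ T : ℝ, IntegrableOn m (Set.Icc 0 T) volume) :
    LocallyIntegrable ((Set.Ici 0).indicator m) volume := by
  rw [locallyIntegrable_iff]
  intro K hK
  obtain ⟨R, hR⟩ := hK.isBounded.subset_closedBall 0
  have h1 : IntegrableOn ((Set.Ici 0).indicator m) (Set.Icc (-R) R) := by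
    rw [integrableOn_indicator_iff measurableSet_Ici]
    exact (hm R).mono_set fun x hx => ⟨hx.1, hx.2.2⟩
  refine h1.mono_set (hR.trans ?_)
  rw [Real.closedBall_eq_Icc]; simp

theorem intervalIntegral_indicator_Ici (m : ℝ → ℝ) {s t : ℝ≥0} (hst : s ≤ t) :
    ∫ r in (s : ℝ)..t, (Set.Ici 0).indicator m r = ∫ r in Set.Icc (s : ℝ) t, m r := by
  rw [intervalIntegral.integral_of_le (by exact_mod_cast hst), ← integral_Icc_eq_integral_Ioc]
  exact setIntegral_congr_fun measurableSet_Icc fun r hr =>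
    Set.indicator_of_mem (show r ∈ Set.Ici (0 : ℝ) from s.2.trans hr.1) m

variable {S : Type*} [MetricSpace S]

theorem LocallyAbsCont.exists_locallyIntegrable {v : ℝ≥0 → S} (hv : LocallyAbsCont v) :
    ∃ m : ℝ → ℝ, LocallyIntegrable m volume ∧
      ∀ s t : ℝ≥0, s ≤ t → dist (v s) (v t) ≤ ∫ r in (s : ℝ)..t, m r := by
  obtain ⟨m, hm, hd⟩ := hv
  exact ⟨_, locallyIntegrable_indicator_Ici hm, fun s t hst =>
    (hd s t hst).trans_eq (intervalIntegral_indicator_Ici m hst).symm⟩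

theorem dist_le_abs_sub_of_le_integral {v : ℝ≥0 → S} {m : ℝ → ℝ} (hm : LocallyIntegrable m volume)
    (hd : ∀ s t : ℝ≥0, s ≤ t → dist (v s) (v t) ≤ ∫ r in (s : ℝ)..t, m r) (c : ℝ) (s t : ℝ≥0) :
    dist (v s) (v t) ≤ |(∫ r in c..(s : ℝ), m r) - ∫ r in c..(t : ℝ), m r| := by
  have hi (a b : ℝ) : IntervalIntegrable m volume a b :=
    intervalIntegrable_iff.mpr ((hm.integrableOn_isCompact isCompact_uIcc).mono_set
      Set.uIoc_subset_uIcc)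
  rw [intervalIntegral.integral_interval_sub_left (hi _ _) (hi _ _)]
  rcases le_total s t with h | h
  · rw [intervalIntegral.integral_symm, abs_neg]
    exact (hd s t h).trans (le_abs_self _)
  · rw [dist_comm]
    exact (hd t s h).trans (le_abs_self _)

theorem LocallyAbsCont.continuous {v : ℝ≥0 → S} (hv : LocallyAbsCont v) : Continuous v := by
  obtain ⟨m, hm, hd⟩ := hv.exists_locallyIntegrable
  have hi (a b : ℝ) : IntervalIntegrable m volume a b :=
    intervalIntegrable_iff.mpr ((hm.integrableOn_isCompact isCompact_uIcc).mono_set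
      Set.uIoc_subset_uIcc)
  have hF : Continuous fun t : ℝ≥0 => ∫ r in (0 : ℝ)..t, m r :=
    (intervalIntegral.continuous_primitive hi 0).comp NNReal.continuous_coe
  rw [continuous_iff_continuousAt]
  intro t
  rw [ContinuousAt, tendsto_iff_dist_tendsto_zero]
  refine squeeze_zero (fun _ => dist_nonneg)
    (fun s => dist_le_abs_sub_of_le_integral hm hd 0 s t) ?_
  have := (hF.sub (continuous_const (y := ∫ r in (0 : ℝ)..t, m r))).abs.tendsto t
  simpa using this

theorem tendsto_coe_nhdsWithin_ne (t : ℝ≥0) :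
    Tendsto (fun s : ℝ≥0 => (s : ℝ)) (𝓝[≠] t) (𝓝[≠] (t : ℝ)) :=
  tendsto_nhdsWithin_of_tendsto_nhds_of_eventually_within _
    (NNReal.continuous_coe.continuousAt.tendsto.mono_left nhdsWithin_le_nhds)
    (eventually_nhdsWithin_of_forall fun s hs => by
      simpa [NNReal.coe_inj] using hs)

theorem edist_div_edist_eq (v : ℝ≥0 → S) {s t : ℝ≥0} (h : s ≠ t) :
    edist (v s) (v t) / edist s t = ENNReal.ofReal (dist (v s) (v t) / |(s : ℝ) - t|) := by
  have h0 : 0 < |(s : ℝ) - t| := abs_pos.2 (sub_ne_zero.2 (by exact_mod_cast h))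
  rw [edist_dist, edist_dist, NNReal.dist_eq, ENNReal.ofReal_div_of_pos h0]

/-- Lebesgue's differentiation theorem bounds the metric derivative by any admissible density. -/
theorem ae_metricDeriv_le {v : ℝ≥0 → S} {m : ℝ → ℝ} (hm : LocallyIntegrable m volume)
    (hd : ∀ s t : ℝ≥0, s ≤ t → dist (v s) (v t) ≤ ∫ r in (s : ℝ)..t, m r) :
    ∀ᵐ r : ℝ, 0 ≤ r → metricDeriv v r.toNNReal ≤ ENNReal.ofReal |m r| := by
  filter_upwards [LocallyIntegrable.ae_hasDerivAt_integral hm] with r hr h0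
  lift r to ℝ≥0 using h0
  rw [Real.toNNReal_coe]
  have := neBot_nhdsWithin_ne r
  have h1 := ((hasDerivAt_iff_tendsto_slope.1 (hr 0)).comp (tendsto_coe_nhdsWithin_ne r)).abs
  have h2 := (ENNReal.continuous_ofReal.tendsto _).comp h1
  rw [← h2.limsup_eq, metricDeriv]
  refine limsup_le_limsup ?_
  filter_upwards [self_mem_nhdsWithin] with s hs
  rw [edist_div_edist_eq v hs]
  simp only [Function.comp_apply, slope_def_field, abs_div]
  gcongr
  exact dist_le_abs_sub_of_le_integral hm hd 0 s r

/-- The derivative of the distance to a point is at most the metric derivative; the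
absolutely continuous distance function is the integral of its derivative. -/
theorem LocallyAbsCont.edist_le_lintegral_metricDeriv {v : ℝ≥0 → S} (hv : LocallyAbsCont v)
    {a b : ℝ≥0} (hab : a ≤ b) :
    edist (v a) (v b) ≤ ∫⁻ r in Set.Icc (a : ℝ) b, metricDeriv v r.toNNReal := by
  obtain ⟨m, hm, hd⟩ := hv.exists_locallyIntegrable
  have hab' : (a : ℝ) ≤ b := by exact_mod_cast hab
  have hi : IntervalIntegrable m volume a b :=
    intervalIntegrable_iff.mpr ((hm.integrableOn_isCompact isCompact_uIcc).mono_set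
      Set.uIoc_subset_uIcc)
  set ψ : ℝ → ℝ := fun r => dist (v a) (v r.toNNReal) with hψ
  have hψd (r s : ℝ) : |ψ r - ψ s| ≤ dist (v r.toNNReal) (v s.toNNReal) := by
    have := abs_dist_sub_le (v r.toNNReal) (v s.toNNReal) (v a)
    simpa [hψ, dist_comm] using this
  have hac : AbsolutelyContinuousOnInterval ψ a b := by
    have hF := hi.absolutelyContinuousOnInterval_intervalIntegral (c := (a : ℝ)) (by simp)
    rw [absolutelyContinuousOnInterval_iff] at hF ⊢
    intro ε hε
    obtain ⟨δ, hδ, H⟩ := hF ε hε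
    refine ⟨δ, hδ, fun E hE hE' => lt_of_le_of_lt ?_ (H E hE hE')⟩
    refine Finset.sum_le_sum fun i hi => ?_
    have hmem := hE.1 i hi
    rw [Set.uIcc_of_le hab'] at hmem
    have e1 : (((E.2 i).1).toNNReal : ℝ) = (E.2 i).1 :=
      Real.coe_toNNReal _ (a.2.trans hmem.1.1)
    have e2 : (((E.2 i).2).toNNReal : ℝ) = (E.2 i).2 :=
      Real.coe_toNNReal _ (a.2.trans hmem.2.1)
    have h := dist_le_abs_sub_of_le_integral hm hd a ((E.2 i).1).toNNReal ((E.2 i).2).toNNReal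
    rw [e1, e2] at h
    rw [Real.dist_eq, Real.dist_eq]
    exact (hψd _ _).trans h
  have hint := hac.integral_deriv_eq_sub
  have hψa : ψ a = 0 := by simp [hψ]
  have hψb : ψ b = dist (v a) (v b) := by simp [hψ]
  rw [hψa, hψb, sub_zero, intervalIntegral.integral_of_le hab',
    ← integral_Icc_eq_integral_Ioc] at hint
  rw [edist_dist, ← hint]
  have hpt : ∀ r ∈ Set.Icc (a : ℝ) b, ‖deriv ψ r‖ₑ ≤ metricDeriv v r.toNNReal := by
    intro r hr
    have h0 : 0 ≤ r := a.2.trans hr.1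
    lift r to ℝ≥0 using h0
    rw [Real.toNNReal_coe]
    by_cases hdiff : DifferentiableAt ℝ ψ r
    · have := neBot_nhdsWithin_ne r
      have h1 := ((hasDerivAt_iff_tendsto_slope.1 hdiff.hasDerivAt).comp
        (tendsto_coe_nhdsWithin_ne r)).enorm
      rw [← h1.limsup_eq, metricDeriv]
      refine limsup_le_limsup ?_
      filter_upwards [self_mem_nhdsWithin] with s hs
      rw [edist_div_edist_eq v hs, ← ofReal_norm]
      simp only [Function.comp_apply, slope_def_field, norm_div, Real.norm_eq_abs]
      gcongr
      have := hψd s r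
      simpa using this
    · simp [deriv_zero_of_not_differentiableAt hdiff]
  calc ENNReal.ofReal (∫ r in Set.Icc (a : ℝ) b, deriv ψ r)
      ≤ ENNReal.ofReal ‖∫ r in Set.Icc (a : ℝ) b, deriv ψ r‖ :=
        ENNReal.ofReal_le_ofReal (Real.le_norm_self _)
    _ = ‖∫ r in Set.Icc (a : ℝ) b, deriv ψ r‖ₑ := ofReal_norm _
    _ ≤ ∫⁻ r in Set.Icc (a : ℝ) b, ‖deriv ψ r‖ₑ := enorm_integral_le_lintegral_enorm _
    _ ≤ _ := setLIntegral_mono' measurableSet_Icc hpt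

/-- For a continuous curve, the supremum of the difference quotients at `t` over the times `s` with
`0 < d(s, t) < ε` is lower semicontinuous in `t`; the metric derivative is an infimum of countably
many such functions. -/
theorem measurable_metricDeriv {v : ℝ≥0 → S} (hv : Continuous v) : Measurable (metricDeriv v) := by
  set q : ℝ≥0 → ℝ≥0 → ℝ≥0∞ := fun s t => edist (v s) (v t) / edist s t with hq
  set F : ℕ → ℝ≥0 → ℝ≥0∞ := fun n t =>
    ⨆ s ∈ {s : ℝ≥0 | s ≠ t ∧ dist s t < 1 / ((n : ℝ) + 1)}, q s t with hF
  have hlsc (n : ℕ) : LowerSemicontinuous (F n) := by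
    intro t c hc
    simp only [hF, lt_iSup_iff] at hc
    obtain ⟨s, ⟨hst, hsd⟩, hc⟩ := hc
    have hne : edist s t ≠ 0 := (edist_pos.2 hst).ne'
    have hcont : ContinuousAt (fun t => q s t) t := by
      refine ENNReal.Tendsto.div ?_ (Or.inr hne) ?_ (Or.inr (edist_ne_top _ _))
      · exact (continuous_const.edist hv).continuousAt
      · exact (continuous_const.edist continuous_id).continuousAt
    have e1 : ∀ᶠ t' in 𝓝 t, c < q s t' := hcont.eventually_const_lt hc
    have e2 : ∀ᶠ t' in 𝓝 t, s ≠ t' := (isOpen_ne (x := s)).eventually_mem hst.symm |>.mono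
      fun _ h => Ne.symm h
    have e3 : ∀ᶠ t' in 𝓝 t, dist s t' < 1 / ((n : ℝ) + 1) :=
      (continuous_const.dist continuous_id).continuousAt.eventually_lt_const hsd
    filter_upwards [e1, e2, e3] with t' h1 h2 h3
    exact h1.trans_le (le_iSup₂_of_le s ⟨h2, h3⟩ le_rfl)
  have hEq : metricDeriv v = fun t => ⨅ n, F n t := by
    funext t
    have hb : (𝓝[≠] t).HasBasis (fun _ : ℕ => True)
        (fun n => {s : ℝ≥0 | s ≠ t ∧ dist s t < 1 / ((n : ℝ) + 1)}) := by
      refine (nhdsWithin_hasBasis Metric.nhds_basis_ball_inv_nat_succ {t}ᶜ).congr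
        (fun _ => Iff.rfl) fun n _ => ?_
      ext s
      simp [and_comm]
    rw [metricDeriv, hb.limsup_eq_iInf_iSup]
    simp [hF, hq]
  rw [hEq]
  exact Measurable.iInf fun n => (hlsc n).measurable

end MinimalGradientFlow

/-! ### Change of variables for monotone Lipschitz maps -/

theorem LipschitzWith.volume_image_eq_zero {f : ℝ → ℝ} (hf : LipschitzWith 1 f)
    {s : Set ℝ} (hs : volume s = 0) : volume (f '' s) = 0 := by
  have h := (hf.lipschitzOnWith (s := s)).hausdorffMeasure_image_le (d := 1) zero_le_one
  rw [hausdorffMeasure_real, hs] at h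
  simpa using h

/-- Change of variables for a monotone Lipschitz map: the points of non-differentiability form a
null set, and so does their image. No measurability of the integrand is needed. -/
theorem lintegral_image_eq_of_monotone_of_lipschitz {z : ℝ → ℝ} (hz : Monotone z)
    (hL : LipschitzWith 1 z) {s : Set ℝ} (hs : MeasurableSet s) (f : ℝ → ℝ≥0∞) :
    ∫⁻ r in z '' s, f r = ∫⁻ t in s, ENNReal.ofReal (deriv z t) * f (z t) := by
  set D : Set ℝ := {t | DifferentiableAt ℝ z t} with hD
  have hDm : MeasurableSet D := measurableSet_of_differentiableAt ℝ z
  have hD0 : volume Dᶜ = 0 := hz.ae_differentiableAt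
  have h0 : volume (s \ D) = 0 := measure_mono_null (fun x hx => hx.2) hD0
  have e1 : (s ∩ D : Set ℝ) =ᵐ[volume] s := by
    rw [← Set.sdiff_sdiff_right_self]
    exact sdiff_null_ae_eq_self h0
  have e2 : (z '' (s ∩ D) : Set ℝ) =ᵐ[volume] z '' s := by
    have : z '' s = z '' (s ∩ D) ∪ z '' (s \ D) := by
      rw [← Set.image_union, Set.inter_union_sdiff]
    rw [this]
    exact (union_ae_eq_left_of_ae_eq_empty
      (ae_eq_empty.2 (hL.volume_image_eq_zero h0))).symm
  rw [← setLIntegral_congr e1, ← setLIntegral_congr e2]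
  exact lintegral_image_eq_lintegral_deriv_mul_of_monotoneOn (hs.inter hDm)
    (fun x hx => (DifferentiableAt.hasDerivAt hx.2).hasDerivWithinAt) (hz.monotoneOn _) f

theorem Monotone.image_Icc_of_continuous {z : ℝ → ℝ} (hz : Monotone z) (hc : Continuous z)
    {a b : ℝ} (hab : a ≤ b) : z '' Set.Icc a b = Set.Icc (z a) (z b) :=
  Set.Subset.antisymm (hz.monotoneOn _).image_Icc_subset
    (intermediate_value_Icc hab hc.continuousOn)

/-! ### The energy identity -/

theorem ENNReal.mul_le_half_sq_add_half_sq (a b : ℝ≥0∞) :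
    a * b ≤ 2⁻¹ * a ^ 2 + 2⁻¹ * b ^ 2 := by
  by_cases ha : a = ⊤
  · simp [ha, ENNReal.mul_top]
  by_cases hb : b = ⊤
  · simp [hb, ENNReal.mul_top]
  lift a to ℝ≥0 using ha
  lift b to ℝ≥0 using hb
  have h2 : (2⁻¹ : ℝ≥0∞) = ((2⁻¹ : ℝ≥0) : ℝ≥0∞) := by simp
  rw [h2]
  norm_cast
  rw [← NNReal.coe_le_coe]
  push_cast
  nlinarith [sq_nonneg ((a : ℝ) - b)]

theorem ENNReal.eq_of_mul_eq_half_sq_add_half_sq {a b : ℝ≥0∞}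
    (h : a * b = 2⁻¹ * a ^ 2 + 2⁻¹ * b ^ 2) (hfin : 2⁻¹ * a ^ 2 + 2⁻¹ * b ^ 2 < ⊤) : a = b := by
  have ha : a ≠ ⊤ := by rintro rfl; simp [ENNReal.mul_top] at hfin
  have hb : b ≠ ⊤ := by rintro rfl; simp [ENNReal.mul_top] at hfin
  lift a to ℝ≥0 using ha
  lift b to ℝ≥0 using hb
  have h2 : (2⁻¹ : ℝ≥0∞) = ((2⁻¹ : ℝ≥0) : ℝ≥0∞) := by simp
  rw [h2] at h
  norm_cast at h
  rw [← NNReal.coe_inj] at h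
  push_cast at h
  have : ((a : ℝ) - b) ^ 2 = 0 := by nlinarith
  have := pow_eq_zero_iff (two_ne_zero) |>.1 this
  norm_cast
  exact NNReal.coe_injective (by linarith)

theorem EReal.coe_ennreal_le_coe_iff {x : ℝ≥0∞} {r : ℝ} :
    (x : EReal) ≤ (r : EReal) ↔ 0 ≤ r ∧ x ≤ ENNReal.ofReal r := by
  constructor
  · intro h
    have h0 : 0 ≤ r := by
      have := (EReal.coe_ennreal_nonneg x).trans h
      exact_mod_cast this
    refine ⟨h0, ?_⟩
    rw [← EReal.coe_ennreal_le_coe_ennreal_iff, EReal.coe_ennreal_ofReal, max_eq_left h0]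
    exact h
  · rintro ⟨h0, h⟩
    rw [← EReal.coe_ennreal_le_coe_ennreal_iff, EReal.coe_ennreal_ofReal, max_eq_left h0] at h
    exact h

namespace MinimalGradientFlow

variable {S : Type*} [MetricSpace S] {φ : S → EReal} {g : S → ℝ≥0∞} {u : ℝ≥0 → S}

theorem coe_toReal_of_mem_solutions (hφ : ∀ x, φ x ≠ ⊥) (hu : u ∈ solutions φ g) (t : ℝ≥0) :
    ((φ (u t)).toReal : EReal) = φ (u t) := by
  refine EReal.coe_toReal (fun h => ?_) (hφ _)
  have := (EReal.coe_ennreal_nonneg _).trans (hu.2.2.2 0 t bot_le)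
  rw [h] at this
  simp at this

theorem dissipation_of_mem_solutions (hφ : ∀ x, φ x ≠ ⊥) (hu : u ∈ solutions φ g)
    {s t : ℝ≥0} (hst : s ≤ t) :
    (φ (u t)).toReal ≤ (φ (u s)).toReal ∧
      (2 : ℝ≥0∞)⁻¹ * (∫⁻ r in Set.Icc (s : ℝ) t, g (u r.toNNReal) ^ 2) +
        (2 : ℝ≥0∞)⁻¹ * (∫⁻ r in Set.Icc (s : ℝ) t, metricDeriv u r.toNNReal ^ 2) ≤
      ENNReal.ofReal ((φ (u s)).toReal - (φ (u t)).toReal) := by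
  have h := hu.2.2.2 s t hst
  rw [← coe_toReal_of_mem_solutions hφ hu s, ← coe_toReal_of_mem_solutions hφ hu t,
    ← EReal.coe_sub, EReal.coe_ennreal_le_coe_iff, sub_nonneg] at h
  exact h

/-- The equality case of Young's inequality in `∫ g |u'| ≤ ½ ∫ g² + ½ ∫ |u'|²`. -/
theorem energy_identity_and_ae_eq (hφ : ∀ x, φ x ≠ ⊥) (hg : IsStrongUpperGradient φ g)
    (hu : u ∈ solutions φ g) {s t : ℝ≥0} (hst : s ≤ t) :
    (∫⁻ r in Set.Icc (s : ℝ) t, g (u r.toNNReal) ^ 2 =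
      ENNReal.ofReal ((φ (u s)).toReal - (φ (u t)).toReal)) ∧
    ∀ᵐ r ∂volume.restrict (Set.Icc (s : ℝ) t), g (u r.toNNReal) = metricDeriv u r.toNNReal := by
  have hgm : Measurable fun r : ℝ => g (u r.toNNReal) := hu.2.1.comp measurable_real_toNNReal
  have hmm : Measurable fun r : ℝ => metricDeriv u r.toNNReal :=
    (measurable_metricDeriv hu.1.continuous).comp measurable_real_toNNReal
  obtain ⟨hmono, h1⟩ := dissipation_of_mem_solutions hφ hu hst
  have h2 := ((hg u hu.1).2 s t hst).2
  rw [← coe_toReal_of_mem_solutions hφ hu s, ← coe_toReal_of_mem_solutions hφ hu t] at h2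
  have h2' : ENNReal.ofReal ((φ (u s)).toReal - (φ (u t)).toReal) ≤
      ∫⁻ r in Set.Icc (s : ℝ) t, g (u r.toNNReal) * metricDeriv u r.toNNReal := by
    rw [← EReal.coe_ennreal_le_coe_ennreal_iff, EReal.coe_ennreal_ofReal,
      max_eq_left (sub_nonneg.2 hmono), EReal.coe_sub]
    exact EReal.sub_le_of_le_add' h2
  rw [← lintegral_const_mul _ (hgm.pow_const 2), ← lintegral_const_mul _ (hmm.pow_const 2),
    ← lintegral_add_left ((hgm.pow_const 2).const_mul _)] at h1
  have hle : ∀ r : ℝ, g (u r.toNNReal) * metricDeriv u r.toNNReal ≤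
      2⁻¹ * g (u r.toNNReal) ^ 2 + 2⁻¹ * metricDeriv u r.toNNReal ^ 2 :=
    fun r => ENNReal.mul_le_half_sq_add_half_sq _ _
  have hkm : Measurable fun r : ℝ =>
      2⁻¹ * g (u r.toNNReal) ^ 2 + 2⁻¹ * metricDeriv u r.toNNReal ^ 2 :=
    ((hgm.pow_const 2).const_mul _).add ((hmm.pow_const 2).const_mul _)
  have hfin := (h1.trans_lt ENNReal.ofReal_lt_top).ne
  have hae := ae_eq_of_ae_le_of_lintegral_le (Eventually.of_forall hle)
    ((lintegral_mono hle).trans_lt hfin.lt_top).ne hkm.aemeasurable (h1.trans h2')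
  have hlt := ae_lt_top hkm hfin
  have heq : ∀ᵐ r ∂volume.restrict (Set.Icc (s : ℝ) t),
      g (u r.toNNReal) = metricDeriv u r.toNNReal := by
    filter_upwards [hae, hlt] with r hr hr'
    exact ENNReal.eq_of_mul_eq_half_sq_add_half_sq hr hr'
  refine ⟨le_antisymm ?_ ?_, heq⟩
  · refine le_trans (le_of_eq (lintegral_congr_ae ?_)) h1
    filter_upwards [heq] with r hr
    rw [← hr, ← add_mul, ENNReal.inv_two_add_inv_two, one_mul]
  · refine h2'.trans (le_of_eq (lintegral_congr_ae ?_))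
    filter_upwards [heq] with r hr
    rw [← hr, sq]

theorem edist_le_lintegral_of_mem_solutions (hφ : ∀ x, φ x ≠ ⊥) (hg : IsStrongUpperGradient φ g)
    (hu : u ∈ solutions φ g) {s t : ℝ≥0} (hst : s ≤ t) :
    edist (u s) (u t) ≤ ∫⁻ r in Set.Icc (s : ℝ) t, g (u r.toNNReal) :=
  (hu.1.edist_le_lintegral_metricDeriv hst).trans
    (lintegral_congr_ae ((energy_identity_and_ae_eq hφ hg hu hst).2.mono fun _ h => h.symm)).le

end MinimalGradientFlow

/-! ### Curves without idle time are minimal -/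

theorem LipschitzWith.coe_comp_toNNReal {z : ℝ≥0 → ℝ≥0} (hz : LipschitzWith 1 z) :
    LipschitzWith 1 fun t : ℝ => (z t.toNNReal : ℝ) := by
  have := NNReal.isometry_coe.lipschitz.comp (hz.comp Real.lipschitzWith_toNNReal)
  rwa [mul_one, mul_one] at this

theorem Monotone.coe_comp_toNNReal {z : ℝ≥0 → ℝ≥0} (hz : Monotone z) :
    Monotone fun t : ℝ => (z t.toNNReal : ℝ) :=
  fun _ _ h => NNReal.coe_le_coe.2 (hz (Real.toNNReal_mono h))

theorem LipschitzWith.deriv_le_one {z : ℝ → ℝ} (hz : LipschitzWith 1 z) (t : ℝ) :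
    deriv z t ≤ 1 := by
  have := norm_deriv_le_of_lipschitz hz (x₀ := t)
  exact (Real.le_norm_self _).trans (by simpa using this)

namespace MinimalGradientFlow

variable {S : Type*} [MetricSpace S] {φ : S → EReal} {g : S → ℝ≥0∞} {u v : ℝ≥0 → S}

/-- The infimum in the definition of `T⋆` is attained by continuity. -/
theorem eq_of_Tstar_le (hu : Continuous u) {τ t : ℝ≥0} (hτ : Tstar u ≤ τ) (ht : τ ≤ t) :
    u t = u τ := by
  have key : ∀ a b : ℝ≥0, τ < a → τ < b → u a = u b := by
    intro a b ha hb
    have hlt : Tstar u < ((min a b : ℝ≥0) : ℝ≥0∞) :=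
      hτ.trans_lt (by exact_mod_cast lt_min ha hb)
    obtain ⟨_, ⟨s, rfl, hs⟩, hsm⟩ := sInf_lt_iff.1 hlt
    have hsm' : s < min a b := by exact_mod_cast hsm
    rw [hs a (hsm'.le.trans (min_le_left _ _)), hs b (hsm'.le.trans (min_le_right _ _))]
  rcases ht.eq_or_lt with rfl | ht
  · rfl
  have h1 : Tendsto u (𝓝[>] τ) (𝓝 (u τ)) := hu.continuousAt.tendsto.mono_left nhdsWithin_le_nhds
  have h2 : Tendsto u (𝓝[>] τ) (𝓝 (u t)) :=
    tendsto_const_nhds.congr' (eventually_nhdsWithin_of_forall fun b hb => key t b ht hb)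
  exact tendsto_nhds_unique h2 h1

/-- The dissipated energy `∫ g²` is the same for `u` and for `v`, so by change of variables
`∫ g²(u) (1 - z') = 0`. -/
theorem ae_deriv_eq_one_of_eq_comp (hφ : ∀ x, φ x ≠ ⊥) (hg : IsStrongUpperGradient φ g)
    (hu : u ∈ solutions φ g) (hv : v ∈ solutions φ g) {z : ℝ≥0 → ℝ≥0} (hzm : Monotone z)
    (hzl : LipschitzWith 1 z) (huv : ∀ t, u t = v (z t)) (T : ℝ≥0) :
    ∀ᵐ r ∂volume.restrict (Set.Icc (0 : ℝ) T), g (u r.toNNReal) ≠ 0 →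
      deriv (fun t : ℝ => (z t.toNNReal : ℝ)) r = 1 := by
  set zr : ℝ → ℝ := fun t => (z t.toNNReal : ℝ) with hzr
  have hL : LipschitzWith 1 zr := hzl.coe_comp_toNNReal
  have hM : Monotone zr := hzm.coe_comp_toNNReal
  have hEu := (energy_identity_and_ae_eq hφ hg hu (zero_le (a := T))).1
  have hEv := (energy_identity_and_ae_eq hφ hg hv (hzm (zero_le (a := T)))).1
  have himg : zr '' Set.Icc 0 T = Set.Icc (z 0 : ℝ) (z T) := by
    rw [hM.image_Icc_of_continuous hL.continuous T.coe_nonneg]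
    simp [hzr]
  rw [← himg, lintegral_image_eq_of_monotone_of_lipschitz hM hL measurableSet_Icc, ← huv, ← huv]
    at hEv
  simp only [hzr, Real.toNNReal_coe, ← huv] at hEv
  rw [NNReal.coe_zero] at hEu
  have hgm : Measurable fun r : ℝ => g (u r.toNNReal) ^ 2 :=
    (hu.2.1.comp measurable_real_toNNReal).pow_const 2
  have hle : ∀ r : ℝ, ENNReal.ofReal (deriv zr r) * g (u r.toNNReal) ^ 2 ≤
      g (u r.toNNReal) ^ 2 := fun r =>
    (mul_le_mul_left (ENNReal.ofReal_le_one.2 (hL.deriv_le_one r)) _).trans_eq (one_mul _)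
  have hae := ae_eq_of_ae_le_of_lintegral_le (μ := volume.restrict (Set.Icc (0 : ℝ) T))
    (Eventually.of_forall hle)
    (by rw [hEv]; exact ENNReal.ofReal_ne_top) hgm.aemeasurable (by rw [hEu, hEv])
  have hlt := ae_lt_top (μ := volume.restrict (Set.Icc (0 : ℝ) T)) hgm
    (by rw [hEu]; exact ENNReal.ofReal_ne_top)
  filter_upwards [hae, hlt] with r hr hr' h0
  have h1 : ENNReal.ofReal (deriv zr r) = 1 := by
    have h3 : g (u r.toNNReal) ^ 2 ≠ 0 := pow_ne_zero 2 h0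
    calc ENNReal.ofReal (deriv zr r)
        = ENNReal.ofReal (deriv zr r) * g (u r.toNNReal) ^ 2 / g (u r.toNNReal) ^ 2 :=
          (ENNReal.mul_div_cancel_right h3 hr'.ne).symm
      _ = 1 := by rw [hr, ENNReal.div_self h3 hr'.ne]
  exact ENNReal.ofReal_eq_one.1 h1

/-- A curve that spends no time in `{g = 0}` before `T⋆` cannot be sped up: the time change is the
identity up to `T⋆`, and afterwards `v` has no state of lower energy left to move to. -/
theorem isMinimal_of_volume_eq_zero (hφ : ∀ x, φ x ≠ ⊥) (hg : IsStrongUpperGradient φ g)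
    (hu : u ∈ solutions φ g)
    (h0 : volume {t : ℝ | 0 ≤ t ∧ ENNReal.ofReal t < Tstar u ∧ g (u t.toNNReal) = 0} = 0) :
    IsMinimal (solutions φ g) u := by
  refine ⟨hu, ?_⟩
  rintro v hv ⟨hrange, z, hzm, hzl, hz0, huv⟩
  have hL : LipschitzWith 1 fun t : ℝ => (z t.toNNReal : ℝ) := hzl.coe_comp_toNNReal
  have hN : ∀ᵐ r : ℝ, ¬ (0 ≤ r ∧ ENNReal.ofReal r < Tstar u ∧ g (u r.toNNReal) = 0) := by
    rw [ae_iff]; simpa using h0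
  have hzid : ∀ T : ℝ≥0, (T : ℝ≥0∞) ≤ Tstar u → z T = T := by
    intro T hT
    have hae : ∀ᵐ r ∂volume.restrict (Set.Icc (0 : ℝ) T),
        deriv (fun t : ℝ => (z t.toNNReal : ℝ)) r = 1 := by
      have hne : ∀ᵐ r : ℝ, r ≠ T := by simp [ae_iff, measure_singleton]
      filter_upwards [ae_deriv_eq_one_of_eq_comp hφ hg hu hv hzm hzl huv T,
        ae_restrict_of_ae hN, ae_restrict_of_ae hne, ae_restrict_mem measurableSet_Icc]
        with r h1 h2 h3 h4
      refine h1 fun h5 => h2 ⟨h4.1, lt_of_lt_of_le ?_ hT, h5⟩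
      rw [ENNReal.ofReal_lt_coe_iff h4.1]
      exact lt_of_le_of_ne h4.2 h3
    have hint := (hL.lipschitzOnWith (s := Set.uIcc (0 : ℝ) T)).absolutelyContinuousOnInterval
      |>.integral_deriv_eq_sub
    rw [intervalIntegral.integral_of_le T.coe_nonneg, ← integral_Icc_eq_integral_Ioc,
      integral_congr_ae hae] at hint
    simp [hz0] at hint
    exact hint.symm
  have hagree : ∀ T : ℝ≥0, (T : ℝ≥0∞) ≤ Tstar u → u T = v T := fun T hT => by
    rw [huv T, hzid T hT]
  funext t
  rcases le_or_gt (t : ℝ≥0∞) (Tstar u) with ht | ht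
  · exact hagree t ht
  obtain ⟨τ, hτ⟩ : ∃ τ : ℝ≥0, (τ : ℝ≥0∞) = Tstar u :=
    ⟨_, ENNReal.coe_toNNReal (ht.trans_le le_top).ne⟩
  have hτt : τ ≤ t := by
    rw [← hτ] at ht; exact_mod_cast ht.le
  have hconst : ∀ r, τ ≤ r → u r = u τ := fun r hr => eq_of_Tstar_le hu.1.continuous hτ.ge hr
  rw [hconst t hτt]
  rcases hrange ⟨t, rfl⟩ with ⟨r, hr⟩ | ⟨s, hs, hlim⟩
  · rcases le_or_gt τ r with hτr | hrτ
    · rw [← hr, hconst r hτr]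
    -- Here `v t = u r` with `r < τ`, but `g(u) > 0` a.e. on `[r, τ]` makes `φ (u r) > φ (u τ)`.
    exfalso
    have h1 : (φ (v t)).toReal ≤ (φ (v τ)).toReal := (dissipation_of_mem_solutions hφ hv hτt).1
    rw [← hr, ← hagree τ hτ.le] at h1
    have hE := (energy_identity_and_ae_eq hφ hg hu hrτ.le).1
    have hgm : Measurable fun r : ℝ => g (u r.toNNReal) ^ 2 :=
      (hu.2.1.comp measurable_real_toNNReal).pow_const 2
    rw [ENNReal.ofReal_of_nonpos (sub_nonpos.2 h1), lintegral_eq_zero_iff hgm] at hE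
    have hfalse : ∀ᵐ x ∂volume.restrict (Set.Ico (r : ℝ) τ), False := by
      filter_upwards [ae_restrict_of_ae_restrict_of_subset Set.Ico_subset_Icc_self hE,
        ae_restrict_of_ae hN, ae_restrict_mem measurableSet_Ico] with x hx hx' hxm
      have hx0 : 0 ≤ x := r.2.trans hxm.1
      refine hx' ⟨hx0, ?_, by simpa using hx⟩
      rw [← hτ, ENNReal.ofReal_lt_coe_iff hx0]
      exact hxm.2
    rw [ae_iff] at hfalse
    simp at hfalse
    exact absurd hrτ (not_lt.2 (by exact_mod_cast hfalse))
  · refine tendsto_nhds_unique (tendsto_const_nhds.congr' ?_) hlim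
    filter_upwards [hs.eventually_ge_atTop τ] with n hn
    exact (hconst _ hn).symm

end MinimalGradientFlow

/-! ### Active time -/

namespace MinimalGradientFlow

variable {S : Type*} {φ : S → EReal} {g : S → ℝ≥0∞} {u : ℝ≥0 → S}

/-- `Z(t) = ℒ¹({r ∈ [0,t] | g(u(r)) ≠ 0})` for `t ≥ 0`, described by the properties that are used:
`Z` counts the time during which the curve `u` is outside the critical set `{g = 0}`. It is a
function on all of `ℝ`, with `u` frozen at `u(0)` before time `0`, so that the calculus of real
functions applies. -/
structure IsActiveTime (g : S → ℝ≥0∞) (u : ℝ≥0 → S) (Z : ℝ → ℝ) : Prop where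
  mono : Monotone Z
  lipschitz : LipschitzWith 1 Z
  zero : Z 0 = 0
  ae_deriv : ∀ᵐ r : ℝ, deriv Z r = {r : ℝ | g (u r.toNNReal) ≠ 0}.indicator 1 r
  volume_eq : ∀ a b : ℝ, a ≤ b →
    volume ({r : ℝ | g (u r.toNNReal) ≠ 0} ∩ Set.Icc a b) = ENNReal.ofReal (Z b - Z a)

theorem exists_isActiveTime (hg : Measurable fun r => g (u r)) : ∃ Z, IsActiveTime g u Z := by
  set N : Set ℝ := {r : ℝ | g (u r.toNNReal) ≠ 0} with hN
  have hNm : MeasurableSet N :=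
    (measurableSet_singleton (0 : ℝ≥0∞)).compl.preimage (hg.comp measurable_real_toNNReal)
  have hloc : LocallyIntegrable (N.indicator (1 : ℝ → ℝ)) volume :=
    (locallyIntegrable_const (1 : ℝ)).indicator hNm
  have hi (a b : ℝ) : IntervalIntegrable (N.indicator (1 : ℝ → ℝ)) volume a b :=
    intervalIntegrable_iff.mpr ((hloc.integrableOn_isCompact isCompact_uIcc).mono_set
      Set.uIoc_subset_uIcc)
  set Z : ℝ → ℝ := fun t => ∫ r in (0 : ℝ)..t, N.indicator (1 : ℝ → ℝ) r with hZ
  have hsub (a b : ℝ) : Z b - Z a = ∫ r in a..b, N.indicator (1 : ℝ → ℝ) r :=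
    intervalIntegral.integral_interval_sub_left (hi _ _) (hi _ _)
  have hvol (a b : ℝ) (hab : a ≤ b) : Z b - Z a = (volume (N ∩ Set.Icc a b)).toReal := by
    rw [hsub, intervalIntegral.integral_of_le hab, ← integral_Icc_eq_integral_Ioc,
      integral_indicator_one hNm, measureReal_def, Measure.restrict_apply hNm]
  have hle (a b : ℝ) : volume (N ∩ Set.Icc a b) ≤ ENNReal.ofReal (b - a) :=
    (measure_mono Set.inter_subset_right).trans_eq Real.volume_Icc
  have hmono : Monotone Z := fun a b hab => by
    rw [← sub_nonneg, hvol a b hab]; exact ENNReal.toReal_nonneg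
  refine ⟨Z, hmono, ?_, by simp [hZ], ?_, fun a b hab => ?_⟩
  · have key (a b : ℝ) (hab : a ≤ b) : |Z b - Z a| ≤ |b - a| := by
      rw [abs_of_nonneg (sub_nonneg.2 (hmono hab)), abs_of_nonneg (sub_nonneg.2 hab), hvol a b hab]
      exact ENNReal.toReal_le_of_le_ofReal (sub_nonneg.2 hab) (hle a b)
    refine LipschitzWith.of_dist_le_mul fun a b => ?_
    rw [NNReal.coe_one, one_mul, Real.dist_eq, Real.dist_eq]
    rcases le_total a b with h | h
    · rw [abs_sub_comm, abs_sub_comm a b]; exact key a b h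
    · exact key b a h
  · filter_upwards [LocallyIntegrable.ae_hasDerivAt_integral hloc] with r hr
    exact (hr 0).deriv
  · rw [hvol a b hab, ENNReal.ofReal_toReal ((hle a b).trans_lt ENNReal.ofReal_lt_top).ne]

theorem IsActiveTime.nonneg {Z : ℝ → ℝ} (hZ : IsActiveTime g u Z) (t : ℝ≥0) : 0 ≤ Z t := by
  rw [← hZ.zero]; exact hZ.mono t.2

theorem IsActiveTime.lt_of_notMem_range {Z : ℝ → ℝ} (hZ : IsActiveTime g u Z) {r : ℝ≥0}
    (hr : ∀ t : ℝ≥0, Z t ≠ r) (t : ℝ≥0) : Z t < r := by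
  by_contra! h
  obtain ⟨x, hx, hxr⟩ := intermediate_value_Icc t.coe_nonneg
    (hZ.lipschitz.continuous.continuousOn (s := Set.Icc (0 : ℝ) t))
    (show (r : ℝ) ∈ Set.Icc (Z 0) (Z t) from ⟨by rw [hZ.zero]; exact r.2, h⟩)
  exact hr ⟨x, hx.1⟩ hxr

variable [MetricSpace S]

/-- The Cauchy–Schwarz inequality for `∫ g(u) = ∫ 1_{g(u) ≠ 0} g(u)`: only active time counts. -/
theorem IsActiveTime.dist_sq_le {Z : ℝ → ℝ} (hZ : IsActiveTime g u Z) (hφ : ∀ x, φ x ≠ ⊥)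
    (hg : IsStrongUpperGradient φ g) (hu : u ∈ solutions φ g) {a b : ℝ≥0} (hab : a ≤ b) :
    dist (u a) (u b) ^ 2 ≤ (Z b - Z a) * ((φ (u a)).toReal - (φ (u b)).toReal) := by
  set N : Set ℝ := {r : ℝ | g (u r.toNNReal) ≠ 0} with hN
  have hgm : Measurable fun r : ℝ => g (u r.toNNReal) := hu.2.1.comp measurable_real_toNNReal
  have hNm : MeasurableSet N := (measurableSet_singleton (0 : ℝ≥0∞)).compl.preimage hgm
  have hab' : (a : ℝ) ≤ b := by exact_mod_cast hab
  have hE := (energy_identity_and_ae_eq hφ hg hu hab).1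
  have h1 := edist_le_lintegral_of_mem_solutions hφ hg hu hab
  have hz0 : 0 ≤ Z b - Z a := sub_nonneg.2 (hZ.mono hab')
  have hp0 := sub_nonneg.2 (dissipation_of_mem_solutions hφ hu hab).1
  have hCS := ENNReal.lintegral_mul_le_Lp_mul_Lq (volume.restrict (Set.Icc (a : ℝ) b))
    (p := 2) (q := 2) (Real.HolderConjugate.two_two)
    (f := N.indicator 1) (g := fun r => g (u r.toNNReal))
    ((measurable_one.indicator hNm).aemeasurable) hgm.aemeasurable
  have e1 : ∫⁻ r in Set.Icc (a : ℝ) b, (N.indicator (1 : ℝ → ℝ≥0∞) *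
      fun r : ℝ => g (u r.toNNReal)) r = ∫⁻ r in Set.Icc (a : ℝ) b, g (u r.toNNReal) := by
    refine lintegral_congr fun r => ?_
    by_cases hr : r ∈ N
    · simp [hr]
    · have : g (u r.toNNReal) = 0 := by simpa [hN] using hr
      simp [this]
  have e2 : ∫⁻ r in Set.Icc (a : ℝ) b, (N.indicator (1 : ℝ → ℝ≥0∞) r) ^ (2 : ℝ) =
      ENNReal.ofReal (Z b - Z a) := by
    rw [← hZ.volume_eq a b hab', ← Measure.restrict_apply hNm, ← lintegral_indicator_one hNm]
    refine lintegral_congr fun r => ?_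
    by_cases hr : r ∈ N <;> simp [hr]
  have e3 : ∫⁻ r in Set.Icc (a : ℝ) b, g (u r.toNNReal) ^ (2 : ℝ) =
      ENNReal.ofReal ((φ (u a)).toReal - (φ (u b)).toReal) := by
    rw [← hE]; simp
  rw [e1, e2, e3] at hCS
  have h2 := h1.trans hCS
  rw [← ENNReal.mul_rpow_of_nonneg _ _ (by norm_num), ← ENNReal.ofReal_mul hz0,
    ENNReal.ofReal_rpow_of_nonneg (mul_nonneg hz0 hp0) (by norm_num), edist_dist,
    ENNReal.ofReal_le_ofReal_iff (by positivity), ← Real.sqrt_eq_rpow] at h2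
  calc _ ≤ Real.sqrt ((Z b - Z a) * ((φ (u a)).toReal - (φ (u b)).toReal)) ^ 2 := by gcongr
    _ = _ := Real.sq_sqrt (mul_nonneg hz0 hp0)

/-- If `δ` bounds the active time after `s` and `B δ ≤ 1/4`, then `d²(u(s), u(t)) ≤ δ (φ(u(s)) -
φ(u(t)))` can be absorbed into the quadratic lower bound of `φ`. -/
theorem exists_le_toReal_of_bounded_activeTime {Z : ℝ → ℝ} (hZ : IsActiveTime g u Z)
    (hφ : ∀ x, φ x ≠ ⊥) (hg : IsStrongUpperGradient φ g) (hu : u ∈ solutions φ g)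
    (hφ_quad : ∃ A B : ℝ, 0 < A ∧ 0 < B ∧ ∃ x₀ : S, ∀ x : S,
      ((-A - B * dist x x₀ ^ 2 : ℝ) : EReal) ≤ φ x)
    {L : ℝ} (hZL : Tendsto (fun t : ℝ≥0 => Z t) atTop (𝓝 L)) (hle : ∀ t : ℝ≥0, Z t ≤ L) :
    ∃ C : ℝ, ∀ t : ℝ≥0, C ≤ (φ (u t)).toReal := by
  obtain ⟨A, B, hA, hB, x₀, hq⟩ := hφ_quad
  have hq' (t : ℝ≥0) : -A - B * dist (u t) x₀ ^ 2 ≤ (φ (u t)).toReal := by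
    have := hq (u t)
    rw [← coe_toReal_of_mem_solutions hφ hu t] at this
    exact_mod_cast this
  obtain ⟨s, hs⟩ := (hZL.eventually_const_lt
    (show L - 1 / (4 * B) < L by have : 0 < 1 / (4 * B) := by positivity
                                 linarith)).exists
  set K : ℝ := (φ (u s)).toReal + A + 2 * B * dist (u s) x₀ ^ 2 with hK
  have hK0 : 0 ≤ K := by
    have := hq' s
    have h2 : 0 ≤ B * dist (u s) x₀ ^ 2 := by positivity
    linarith
  refine ⟨(φ (u s)).toReal - 2 * K, fun t => ?_⟩
  rcases le_total t s with hts | hst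
  · have := (dissipation_of_mem_solutions hφ hu hts).1
    linarith
  · have hp := sub_nonneg.2 (dissipation_of_mem_solutions hφ hu hst).1
    have h1 := hZ.dist_sq_le hφ hg hu hst
    set d := dist (u s) (u t) with hd
    have h2 : d ^ 2 ≤ 1 / (4 * B) * ((φ (u s)).toReal - (φ (u t)).toReal) :=
      h1.trans (mul_le_mul_of_nonneg_right (by linarith [hle t]) hp)
    have h3 : 4 * B * d ^ 2 ≤ (φ (u s)).toReal - (φ (u t)).toReal := by
      calc 4 * B * d ^ 2 ≤ 4 * B * (1 / (4 * B) * ((φ (u s)).toReal - (φ (u t)).toReal)) := by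
            gcongr
        _ = _ := by field_simp
    have h4 : dist (u t) x₀ ≤ d + dist (u s) x₀ := by
      rw [hd, dist_comm (u s)]; exact dist_triangle _ _ _
    have h5 : dist (u t) x₀ ^ 2 ≤ 2 * d ^ 2 + 2 * dist (u s) x₀ ^ 2 := by
      have : dist (u t) x₀ ^ 2 ≤ (d + dist (u s) x₀) ^ 2 := by gcongr
      nlinarith [sq_nonneg (d - dist (u s) x₀)]
    have h6 : B * dist (u t) x₀ ^ 2 ≤ B * (2 * d ^ 2 + 2 * dist (u s) x₀ ^ 2) := by gcongr
    have h7 := hq' t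
    linarith

/-- A curve with finite total active time converges to a critical point of lowest energy. -/
theorem exists_limit_of_bounded_activeTime [CompleteSpace S] {Z : ℝ → ℝ} (hZ : IsActiveTime g u Z)
    (hφ : ∀ x, φ x ≠ ⊥) (hφ_lsc : LowerSemicontinuous φ) (hg_lsc : LowerSemicontinuous g)
    (hφ_quad : ∃ A B : ℝ, 0 < A ∧ 0 < B ∧ ∃ x₀ : S, ∀ x : S,
      ((-A - B * dist x x₀ ^ 2 : ℝ) : EReal) ≤ φ x)
    (hg : IsStrongUpperGradient φ g) (hu : u ∈ solutions φ g)
    (hb : BddAbove (Set.range fun t : ℝ≥0 => Z t)) :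
    ∃ w, Tendsto u atTop (𝓝 w) ∧ g w = 0 ∧ ∀ t, φ w ≤ φ (u t) := by
  have hZm : Monotone fun t : ℝ≥0 => Z t := hZ.mono.comp NNReal.coe_mono
  have hZL := tendsto_atTop_ciSup hZm hb
  set L := ⨆ t : ℝ≥0, Z t
  have hle : ∀ t : ℝ≥0, Z t ≤ L := fun t => le_ciSup hb t
  obtain ⟨C, hC⟩ := exists_le_toReal_of_bounded_activeTime hZ hφ hg hu hφ_quad hZL hle
  have hanti : ∀ s t : ℝ≥0, s ≤ t → (φ (u t)).toReal ≤ (φ (u s)).toReal := fun s t hst =>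
    (dissipation_of_mem_solutions hφ hu hst).1
  have hcauchy : CauchySeq u := by
    refine cauchySeq_of_le_tendsto_0' (fun t : ℝ≥0 => √((L - Z t) * ((φ (u 0)).toReal - C)))
      (fun s t hst => ?_) ?_
    · refine Real.le_sqrt_of_sq_le ((hZ.dist_sq_le hφ hg hu hst).trans ?_)
      have := hanti 0 s bot_le
      have := hanti s t hst
      have := hC t
      have := hle t
      have := hle s
      gcongr
    · have := ((tendsto_const_nhds (x := L)).sub hZL).mul_const ((φ (u 0)).toReal - C)
      simpa [Function.comp_def] using (Real.continuous_sqrt.tendsto _).comp this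
  obtain ⟨w, hw⟩ := cauchySeq_tendsto_of_complete hcauchy
  refine ⟨w, hw, ?_, fun t => ?_⟩
  · -- Otherwise `g(u)` stays above some `c > 0` and dissipates an infinite amount of energy.
    by_contra hne
    obtain ⟨c, hc0, hcw⟩ := exists_between (pos_iff_ne_zero.2 hne)
    obtain ⟨T, hT⟩ := eventually_atTop.1 (hw.eventually (hg_lsc w c hcw))
    have hbound : ∀ n : ℕ, c ^ 2 * n ≤ ENNReal.ofReal ((φ (u T)).toReal - C) := by
      intro n
      have hTn : T ≤ T + n := le_self_add
      have hE := (energy_identity_and_ae_eq hφ hg hu hTn).1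
      calc c ^ 2 * n = ∫⁻ _ in Set.Icc (T : ℝ) (T + n : ℝ≥0), c ^ 2 := by simp
        _ ≤ ∫⁻ r in Set.Icc (T : ℝ) (T + n : ℝ≥0), g (u r.toNNReal) ^ 2 := by
          refine setLIntegral_mono' measurableSet_Icc fun r hr => ?_
          gcongr
          exact (hT _ (NNReal.le_toNNReal_of_coe_le hr.1)).le
        _ ≤ _ := by
          rw [hE]
          exact ENNReal.ofReal_le_ofReal (by linarith [hC (T + n)])
    have hc2 : c ^ 2 ≠ 0 := pow_ne_zero 2 hc0.ne'
    obtain ⟨n, hn⟩ := ENNReal.exists_nat_mul_gt hc2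
      (b := ENNReal.ofReal ((φ (u T)).toReal - C)) ENNReal.ofReal_ne_top
    rw [mul_comm] at hn
    exact absurd (hbound n) (not_le.2 hn)
  · by_contra! hlt
    obtain ⟨s, hs, hts⟩ := ((hw.eventually (hφ_lsc w _ hlt)).and (eventually_ge_atTop t)).exists
    rw [← coe_toReal_of_mem_solutions hφ hu t, ← coe_toReal_of_mem_solutions hφ hu s] at hs
    exact absurd (hanti t s hts) (not_le.2 (by exact_mod_cast hs))

end MinimalGradientFlow

/-! ### Running a curve in its active time -/

namespace MinimalGradientFlow

variable {S : Type*} [MetricSpace S] {φ : S → EReal} {g : S → ℝ≥0∞} {u v : ℝ≥0 → S}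
  {Z : ℝ → ℝ} {w : S}

/-- `v` is the curve `u` run in its active time `Z`: `v(Z(t)) = u(t)`. At times that `Z` does not
reach, `v` rests at `w`, which is then required to be a critical limit point of `u` with
`φ(w) ≤ φ(u(t))`. -/
structure IsReduction (φ : S → EReal) (g : S → ℝ≥0∞) (u : ℝ≥0 → S) (Z : ℝ → ℝ) (w : S)
    (v : ℝ≥0 → S) : Prop where
  apply_activeTime : ∀ t : ℝ≥0, v (Z t).toNNReal = u t
  off_range : ∀ r : ℝ≥0, (∀ t : ℝ≥0, Z t ≠ r) →
    v r = w ∧ Tendsto u atTop (𝓝 w) ∧ g w = 0 ∧ ∀ t, φ w ≤ φ (u t)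

theorem exists_isReduction [CompleteSpace S] (hZ : IsActiveTime g u Z)
    (hφ : ∀ x, φ x ≠ ⊥) (hφ_lsc : LowerSemicontinuous φ) (hg_lsc : LowerSemicontinuous g)
    (hφ_quad : ∃ A B : ℝ, 0 < A ∧ 0 < B ∧ ∃ x₀ : S, ∀ x : S,
      ((-A - B * dist x x₀ ^ 2 : ℝ) : EReal) ≤ φ x)
    (hg : IsStrongUpperGradient φ g) (hu : u ∈ solutions φ g) :
    ∃ w v, IsReduction φ g u Z w v := by
  obtain ⟨w, hw⟩ : ∃ w, BddAbove (Set.range fun t : ℝ≥0 => Z t) →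
      Tendsto u atTop (𝓝 w) ∧ g w = 0 ∧ ∀ t, φ w ≤ φ (u t) := by
    by_cases hb : BddAbove (Set.range fun t : ℝ≥0 => Z t)
    · obtain ⟨w, hw⟩ := exists_limit_of_bounded_activeTime hZ hφ hφ_lsc hg_lsc hφ_quad hg hu hb
      exact ⟨w, fun _ => hw⟩
    · exact ⟨u 0, fun h => absurd h hb⟩
  -- `u` does not move while `Z` is constant, so `v` is well defined on the range of `Z`.
  have hfac : Function.FactorsThrough u fun t : ℝ≥0 => (Z t).toNNReal := by
    have key : ∀ a b : ℝ≥0, a ≤ b → Z a = Z b → u a = u b := fun a b hab h => by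
      have := hZ.dist_sq_le hφ hg hu hab
      rw [h, sub_self, zero_mul] at this
      exact dist_eq_zero.1 (pow_eq_zero_iff two_ne_zero |>.1 (le_antisymm this (sq_nonneg _)))
    intro a b h
    have h' : Z a = Z b := (Real.toNNReal_eq_toNNReal_iff (hZ.nonneg a) (hZ.nonneg b)).1 h
    rcases le_total a b with hab | hab
    · exact key a b hab h'
    · exact (key b a hab h'.symm).symm
  refine ⟨w, Function.extend (fun t : ℝ≥0 => (Z t).toNNReal) u fun _ => w,
    fun t => hfac.extend_apply _ t, fun r hr => ⟨?_, hw ?_⟩⟩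
  · refine Function.extend_apply' _ _ _ ?_
    rintro ⟨t, rfl⟩
    exact hr t (Real.coe_toNNReal _ (hZ.nonneg t)).symm
  · refine ⟨r, ?_⟩
    rintro _ ⟨t, rfl⟩
    exact (hZ.lt_of_notMem_range hr t).le

/-- Change of variables for the active time, whose derivative is the indicator function of
`{g ∘ u ≠ 0}`. -/
theorem IsReduction.lintegral_Icc_eq (hv : IsReduction φ g u Z w v) (hZ : IsActiveTime g u Z)
    (f : S → ℝ≥0∞) {a b : ℝ≥0} (hab : a ≤ b) :
    ∫⁻ r in Set.Icc (Z a) (Z b), f (v r.toNNReal) = ∫⁻ r in Set.Icc (a : ℝ) b,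
      {r : ℝ | g (u r.toNNReal) ≠ 0}.indicator (fun r => f (u r.toNNReal)) r := by
  rw [← hZ.mono.image_Icc_of_continuous hZ.lipschitz.continuous (NNReal.coe_le_coe.2 hab),
    lintegral_image_eq_of_monotone_of_lipschitz hZ.mono hZ.lipschitz measurableSet_Icc]
  refine lintegral_congr_ae ?_
  filter_upwards [ae_restrict_of_ae hZ.ae_deriv, ae_restrict_mem measurableSet_Icc] with r hr hm
  have h0 : 0 ≤ r := a.2.trans hm.1
  have hur := hv.apply_activeTime r.toNNReal
  rw [Real.coe_toNNReal r h0] at hur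
  rw [hr, hur]
  by_cases h : g (u r.toNNReal) = 0 <;> simp [h]

theorem IsReduction.lintegral_eq (hv : IsReduction φ g u Z w v) (hZ : IsActiveTime g u Z)
    {f : S → ℝ≥0∞} (hf : ∀ x, g x = 0 → f x = 0) {a b : ℝ≥0} (hab : a ≤ b) :
    ∫⁻ r in Set.Icc (Z a) (Z b), f (v r.toNNReal) =
      ∫⁻ r in Set.Icc (a : ℝ) b, f (u r.toNNReal) := by
  rw [hv.lintegral_Icc_eq hZ f hab]
  refine lintegral_congr fun r => ?_
  by_cases h : g (u r.toNNReal) = 0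
  · simp [h, hf]
  · simp [h]

/-- Case distinction for two times: both are reached by `Z`, or only the first, or none. -/
theorem IsReduction.rec_le (hv : IsReduction φ g u Z w v) (hZ : IsActiveTime g u Z)
    {P : ℝ≥0 → ℝ≥0 → Prop}
    (h₁ : ∀ a b : ℝ≥0, a ≤ b → P (Z a).toNNReal (Z b).toNNReal)
    (h₂ : ∀ a t : ℝ≥0, (∀ b : ℝ≥0, Z b < t) → v t = w → Tendsto u atTop (𝓝 w) → g w = 0 →
      (∀ b, φ w ≤ φ (u b)) → P (Z a).toNNReal t)
    (h₃ : ∀ s t : ℝ≥0, s ≤ t → (∀ r, s ≤ r → v r = w) → g w = 0 →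
      (∀ b, φ w ≤ φ (u b)) → P s t)
    {s t : ℝ≥0} (hst : s ≤ t) : P s t := by
  by_cases hs : ∀ a : ℝ≥0, Z a ≠ s
  · obtain ⟨-, -, hg0, hle⟩ := hv.off_range s hs
    refine h₃ s t hst (fun r hr => (hv.off_range r fun a => ?_).1) hg0 hle
    exact ((hZ.lt_of_notMem_range hs a).trans_le (by exact_mod_cast hr)).ne
  push Not at hs
  obtain ⟨a, ha⟩ := hs
  have ha' : s = (Z a).toNNReal := by rw [ha, Real.toNNReal_coe]
  by_cases ht : ∀ b : ℝ≥0, Z b ≠ t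
  · obtain ⟨hvt, hlim, hg0, hle⟩ := hv.off_range t ht
    rw [ha']
    exact h₂ a t (hZ.lt_of_notMem_range ht) hvt hlim hg0 hle
  push Not at ht
  obtain ⟨b, hb⟩ := ht
  have hb' : t = (Z b).toNNReal := by rw [hb, Real.toNNReal_coe]
  rcases le_total a b with hab | hab
  · rw [ha', hb']; exact h₁ a b hab
  · have hts : t = s := le_antisymm (by
      have := hZ.mono (NNReal.coe_le_coe.2 hab)
      rw [ha, hb] at this
      exact_mod_cast this) hst
    rw [hts, ha']; exact h₁ a a le_rfl

theorem toReal_le_of_mem_solutions (hφ : ∀ x, φ x ≠ ⊥) (hu : u ∈ solutions φ g) {t : ℝ≥0}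
    (hw : φ w ≤ φ (u t)) : (φ w).toReal ≤ (φ (u t)).toReal :=
  EReal.toReal_le_toReal hw (hφ w) fun h => by
    rw [← coe_toReal_of_mem_solutions hφ hu t] at h
    exact EReal.coe_ne_top _ h

theorem IsReduction.toReal_le (hv : IsReduction φ g u Z w v) (hZ : IsActiveTime g u Z)
    (hφ : ∀ x, φ x ≠ ⊥) (hu : u ∈ solutions φ g) {s t : ℝ≥0} (hst : s ≤ t) :
    (φ (v t)).toReal ≤ (φ (v s)).toReal := by
  refine hv.rec_le hZ (P := fun s t => (φ (v t)).toReal ≤ (φ (v s)).toReal) ?_ ?_ ?_ hst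
  · intro a b hab
    rw [hv.apply_activeTime, hv.apply_activeTime]
    exact (dissipation_of_mem_solutions hφ hu hab).1
  · intro a t _ hvt _ _ hle
    rw [hv.apply_activeTime, hvt]
    exact toReal_le_of_mem_solutions hφ hu (hle a)
  · intro s t hst hvw _ _
    rw [hvw s le_rfl, hvw t hst]

theorem IsReduction.ne_top (hv : IsReduction φ g u Z w v) (hφ : ∀ x, φ x ≠ ⊥)
    (hu : u ∈ solutions φ g) (t : ℝ≥0) : φ (v t) ≠ ⊤ := by
  have hu0 : ∀ a, φ (u a) ≠ ⊤ := fun a => by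
    rw [← coe_toReal_of_mem_solutions hφ hu a]; exact EReal.coe_ne_top _
  by_cases ht : ∀ b : ℝ≥0, Z b ≠ t
  · obtain ⟨hvt, -, -, hle⟩ := hv.off_range t ht
    rw [hvt]
    exact ((hle 0).trans_lt (lt_top_iff_ne_top.2 (hu0 0))).ne
  · push Not at ht
    obtain ⟨b, hb⟩ := ht
    have := hv.apply_activeTime b
    rw [hb, Real.toNNReal_coe] at this
    rw [this]; exact hu0 b

theorem IsReduction.dist_sq_le (hv : IsReduction φ g u Z w v) (hZ : IsActiveTime g u Z)
    (hφ : ∀ x, φ x ≠ ⊥) (hg : IsStrongUpperGradient φ g) (hu : u ∈ solutions φ g)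
    {s t : ℝ≥0} (hst : s ≤ t) :
    dist (v s) (v t) ^ 2 ≤ ((t : ℝ) - s) * ((φ (v s)).toReal - (φ (v t)).toReal) := by
  refine hv.rec_le hZ (P := fun s t => dist (v s) (v t) ^ 2 ≤
    ((t : ℝ) - s) * ((φ (v s)).toReal - (φ (v t)).toReal)) ?_ ?_ ?_ hst
  · intro a b hab
    rw [hv.apply_activeTime, hv.apply_activeTime, Real.coe_toNNReal _ (hZ.nonneg a),
      Real.coe_toNNReal _ (hZ.nonneg b)]
    exact hZ.dist_sq_le hφ hg hu hab
  · intro a t hlt hvt hlim _ hle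
    rw [hv.apply_activeTime, hvt, Real.coe_toNNReal _ (hZ.nonneg a)]
    refine le_of_tendsto ((tendsto_const_nhds.dist hlim).pow 2) ?_
    filter_upwards [eventually_ge_atTop a] with b hab
    refine (hZ.dist_sq_le hφ hg hu hab).trans ?_
    have h1 := toReal_le_of_mem_solutions hφ hu (hle b)
    have h2 := toReal_le_of_mem_solutions hφ hu (hle a)
    have h3 := (hlt b).le
    exact mul_le_mul (by linarith) (by linarith)
      (sub_nonneg.2 (dissipation_of_mem_solutions hφ hu hab).1)
      (sub_nonneg.2 (hlt a).le)
  · intro s t hst hvw _ _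
    rw [hvw s le_rfl, hvw t hst]
    simp

theorem IsReduction.continuous (hv : IsReduction φ g u Z w v) (hZ : IsActiveTime g u Z)
    (hφ : ∀ x, φ x ≠ ⊥) (hg : IsStrongUpperGradient φ g) (hu : u ∈ solutions φ g) :
    Continuous v := by
  rw [continuous_iff_continuousAt]
  intro t
  set E : ℝ := (φ (v 0)).toReal - (φ (v (t + 1))).toReal with hE
  -- On `[0, t + 1]` the curve is Hölder continuous with exponent `1/2` and constant `√E`.
  have key : ∀ a b : ℝ≥0, a ≤ b → b ≤ t + 1 → dist (v a) (v b) ≤ √(|(a : ℝ) - b| * E) := by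
    intro a b hab hb
    refine Real.le_sqrt_of_sq_le ((hv.dist_sq_le hZ hφ hg hu hab).trans ?_)
    have h1 := hv.toReal_le hZ hφ hu (zero_le (a := a))
    have h2 := hv.toReal_le hZ hφ hu hb
    have h3 := hv.toReal_le hZ hφ hu hab
    rw [abs_sub_comm]
    exact mul_le_mul (le_abs_self _) (by linarith) (by linarith) (abs_nonneg _)
  rw [ContinuousAt, tendsto_iff_dist_tendsto_zero]
  have hlim : Tendsto (fun s : ℝ≥0 => √(|(s : ℝ) - t| * E)) (𝓝 t) (𝓝 0) := by
    have : Continuous fun s : ℝ≥0 => √(|(s : ℝ) - t| * E) := by fun_prop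
    simpa using this.tendsto t
  refine squeeze_zero' (Eventually.of_forall fun _ => dist_nonneg) ?_ hlim
  filter_upwards [eventually_le_nhds (show t < t + 1 from lt_add_of_pos_right t one_pos)] with s hs
  rcases le_total s t with h | h
  · exact key s t h (le_self_add)
  · rw [dist_comm, abs_sub_comm]
    exact key t s h hs

/-- The energy dissipated by the reduction: times that `Z` does not reach contribute nothing, since
`g(w) = 0`. -/
theorem IsReduction.lintegral_sq_le (hv : IsReduction φ g u Z w v) (hZ : IsActiveTime g u Z)
    (hφ : ∀ x, φ x ≠ ⊥) (hg : IsStrongUpperGradient φ g) (hu : u ∈ solutions φ g)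
    {s t : ℝ≥0} (hst : s ≤ t) :
    ∫⁻ r in Set.Icc (s : ℝ) t, g (v r.toNNReal) ^ 2 ≤
      ENNReal.ofReal ((φ (v s)).toReal - (φ (v t)).toReal) := by
  have hf : ∀ x, g x = 0 → g x ^ 2 = 0 := fun x hx => by simp [hx]
  refine hv.rec_le hZ (P := fun s t => ∫⁻ r in Set.Icc (s : ℝ) t, g (v r.toNNReal) ^ 2 ≤
      ENNReal.ofReal ((φ (v s)).toReal - (φ (v t)).toReal)) ?_ ?_ ?_ hst
  · intro a b hab
    rw [hv.apply_activeTime, hv.apply_activeTime, Real.coe_toNNReal _ (hZ.nonneg a),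
      Real.coe_toNNReal _ (hZ.nonneg b), hv.lintegral_eq hZ (f := fun x => g x ^ 2) hf hab]
    exact (energy_identity_and_ae_eq hφ hg hu hab).1.le
  · intro a t hlt hvt hlim hg0 hle
    rw [hv.apply_activeTime, hvt, Real.coe_toNNReal _ (hZ.nonneg a)]
    -- `U` is the part of the range of `Z` above `Z a`.
    set U : Set ℝ := ⋃ n : ℕ, Set.Icc (Z a) (Z ((a + n : ℝ≥0) : ℝ)) with hU
    have hUm : MeasurableSet U := MeasurableSet.iUnion fun _ => measurableSet_Icc
    have hdir : Directed (· ⊆ ·) fun n : ℕ => Set.Icc (Z a) (Z ((a + n : ℝ≥0) : ℝ)) :=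
      directed_of_isDirected_le fun m n hmn => Set.Icc_subset_Icc_right (hZ.mono (by
        push_cast; gcongr))
    calc ∫⁻ r in Set.Icc (Z a) t, g (v r.toNNReal) ^ 2
        ≤ ∫⁻ r in Set.Icc (Z a) t, U.indicator (fun r => g (v r.toNNReal) ^ 2) r := by
          refine setLIntegral_mono' measurableSet_Icc fun r hr => ?_
          by_cases hrU : r ∈ U
          · simp [hrU]
          have hr0 : 0 ≤ r := (hZ.nonneg a).trans hr.1
          have hoff : ∀ b : ℝ≥0, Z b ≠ r.toNNReal := by
            intro b hb
            rw [Real.coe_toNNReal r hr0] at hb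
            obtain ⟨n, hn⟩ := exists_nat_ge b
            refine hrU (Set.mem_iUnion.2 ⟨n, hr.1, ?_⟩)
            rw [← hb]
            exact hZ.mono (NNReal.coe_le_coe.2 (hn.trans le_add_self))
          simp [(hv.off_range _ hoff).1, hg0]
      _ ≤ ∫⁻ r, U.indicator (fun r => g (v r.toNNReal) ^ 2) r := setLIntegral_le_lintegral _ _
      _ = ∫⁻ r in U, g (v r.toNNReal) ^ 2 := lintegral_indicator hUm _
      _ = ⨆ n : ℕ, ∫⁻ r in Set.Icc (Z a) (Z ((a + n : ℝ≥0) : ℝ)), g (v r.toNNReal) ^ 2 :=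
          setLIntegral_iUnion_of_directed _ hdir
      _ ≤ _ := by
          refine iSup_le fun n => ?_
          have hab : a ≤ a + n := le_self_add
          rw [hv.lintegral_eq hZ (f := fun x => g x ^ 2) hf hab,
            (energy_identity_and_ae_eq hφ hg hu hab).1]
          have := toReal_le_of_mem_solutions hφ hu (hle (a + n))
          exact ENNReal.ofReal_le_ofReal (by linarith)
  · intro s t hst hvw hg0 _
    refine le_of_eq_of_le ?_ zero_le
    rw [setLIntegral_congr_fun (g := fun _ => 0) measurableSet_Icc fun r hr => ?_, lintegral_zero]
    simp [hvw _ (NNReal.le_toNNReal_of_coe_le hr.1), hg0]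

theorem IsReduction.edist_le_lintegral (hv : IsReduction φ g u Z w v) (hZ : IsActiveTime g u Z)
    (hφ : ∀ x, φ x ≠ ⊥) (hg : IsStrongUpperGradient φ g) (hu : u ∈ solutions φ g)
    {s t : ℝ≥0} (hst : s ≤ t) :
    edist (v s) (v t) ≤ ∫⁻ r in Set.Icc (s : ℝ) t, g (v r.toNNReal) := by
  refine hv.rec_le hZ (P := fun s t => edist (v s) (v t) ≤
    ∫⁻ r in Set.Icc (s : ℝ) t, g (v r.toNNReal)) ?_ ?_ ?_ hst
  · intro a b hab
    rw [hv.apply_activeTime, hv.apply_activeTime, Real.coe_toNNReal _ (hZ.nonneg a),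
      Real.coe_toNNReal _ (hZ.nonneg b), hv.lintegral_eq hZ (f := g) (fun _ h => h) hab]
    exact edist_le_lintegral_of_mem_solutions hφ hg hu hab
  · intro a t hlt hvt hlim _ hle
    rw [hv.apply_activeTime, hvt, Real.coe_toNNReal _ (hZ.nonneg a)]
    refine le_of_tendsto (tendsto_const_nhds.edist hlim) ?_
    filter_upwards [eventually_ge_atTop a] with b hab
    refine (edist_le_lintegral_of_mem_solutions hφ hg hu hab).trans ?_
    rw [← hv.lintegral_eq hZ (f := g) (fun _ h => h) hab]
    exact lintegral_mono_set (Set.Icc_subset_Icc_right (hlt b).le)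
  · intro s t hst hvw _ _
    rw [hvw s le_rfl, hvw t hst]
    simp

end MinimalGradientFlow

/-! ### The reduced curve is a solution without idle time -/

namespace MinimalGradientFlow

variable {S : Type*} [MetricSpace S] {φ : S → EReal} {g : S → ℝ≥0∞} {u v : ℝ≥0 → S}
  {Z : ℝ → ℝ} {w : S}

/-- A curve with `d(v(s), v(t)) ≤ ∫ g(v)` and `∫ g²(v) ≤ φ(v(s)) - φ(v(t))` belongs to `𝒰(φ, g)`,
because then `|v'| ≤ g(v)` almost everywhere. -/
theorem mem_solutions_of_lintegral_le (hφ : ∀ x, φ x ≠ ⊥) (htop : ∀ t, φ (v t) ≠ ⊤)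
    (hgm : Measurable fun r => g (v r))
    (hmono : ∀ s t : ℝ≥0, s ≤ t → (φ (v t)).toReal ≤ (φ (v s)).toReal)
    (hE : ∀ s t : ℝ≥0, s ≤ t → ∫⁻ r in Set.Icc (s : ℝ) t, g (v r.toNNReal) ^ 2 ≤
      ENNReal.ofReal ((φ (v s)).toReal - (φ (v t)).toReal))
    (hd : ∀ s t : ℝ≥0, s ≤ t →
      edist (v s) (v t) ≤ ∫⁻ r in Set.Icc (s : ℝ) t, g (v r.toNNReal)) :
    v ∈ solutions φ g := by
  set G : ℝ → ℝ≥0∞ := fun r => g (v r.toNNReal) with hG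
  have hGm : Measurable G := hgm.comp measurable_real_toNNReal
  have hfin (s t : ℝ≥0) (hst : s ≤ t) : ∫⁻ r in Set.Icc (s : ℝ) t, G r ≠ ⊤ := by
    have hle : ∀ r, G r ≤ 1 + G r ^ 2 := fun r => by
      rcases le_total (G r) 1 with h | h
      · exact h.trans le_self_add
      · exact (le_self_pow₀ h two_ne_zero).trans le_add_self
    refine ((lintegral_mono hle).trans_lt ?_).ne
    rw [lintegral_add_left measurable_const]
    refine ENNReal.add_lt_top.2 ⟨by simp, (hE s t hst).trans_lt ENNReal.ofReal_lt_top⟩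
  have hint : ∀ T : ℝ, IntegrableOn (fun r => (G r).toReal) (Set.Icc 0 T) volume := by
    intro T
    rcases le_or_gt 0 T with hT | hT
    · lift T to ℝ≥0 using hT
      have := hfin 0 T bot_le
      rw [NNReal.coe_zero] at this
      exact integrable_toReal_of_lintegral_ne_top hGm.aemeasurable this
    · simp [Set.Icc_eq_empty hT.not_ge]
  have hdist : ∀ s t : ℝ≥0, s ≤ t →
      dist (v s) (v t) ≤ ∫ r in Set.Icc (s : ℝ) t, (G r).toReal := by
    intro s t hst
    rw [integral_toReal hGm.aemeasurable (ae_lt_top hGm (hfin s t hst)), dist_edist]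
    exact ENNReal.toReal_mono (hfin s t hst) (hd s t hst)
  have hmd : ∀ᵐ r : ℝ, 0 ≤ r → metricDeriv v r.toNNReal ≤ G r := by
    filter_upwards [ae_metricDeriv_le (locallyIntegrable_indicator_Ici hint) fun s t hst =>
      (hdist s t hst).trans_eq (intervalIntegral_indicator_Ici _ hst).symm] with r hr h0
    refine (hr h0).trans ?_
    rw [Set.indicator_of_mem (show r ∈ Set.Ici (0 : ℝ) from h0),
      abs_of_nonneg ENNReal.toReal_nonneg]
    exact ENNReal.ofReal_toReal_le
  refine ⟨⟨_, hint, hdist⟩, hgm, lt_top_iff_ne_top.2 (htop 0), fun s t hst => ?_⟩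
  rw [← EReal.coe_toReal (htop s) (hφ _), ← EReal.coe_toReal (htop t) (hφ _), ← EReal.coe_sub,
    EReal.coe_ennreal_le_coe_iff]
  refine ⟨sub_nonneg.2 (hmono s t hst), le_trans ?_ (hE s t hst)⟩
  have hle : ∫⁻ r in Set.Icc (s : ℝ) t, metricDeriv v r.toNNReal ^ 2 ≤
      ∫⁻ r in Set.Icc (s : ℝ) t, G r ^ 2 := by
    refine lintegral_mono_ae ?_
    filter_upwards [ae_restrict_of_ae hmd, ae_restrict_mem measurableSet_Icc] with r hr hm
    gcongr
    exact hr (s.2.trans hm.1)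
  calc _ ≤ 2⁻¹ * (∫⁻ r in Set.Icc (s : ℝ) t, G r ^ 2) +
        2⁻¹ * ∫⁻ r in Set.Icc (s : ℝ) t, G r ^ 2 := by gcongr
    _ = _ := by rw [← add_mul, ENNReal.inv_two_add_inv_two, one_mul]

theorem IsReduction.mem_solutions (hv : IsReduction φ g u Z w v) (hZ : IsActiveTime g u Z)
    (hφ : ∀ x, φ x ≠ ⊥) (hg_lsc : LowerSemicontinuous g) (hg : IsStrongUpperGradient φ g)
    (hu : u ∈ solutions φ g) : v ∈ solutions φ g :=
  mem_solutions_of_lintegral_le hφ (hv.ne_top hφ hu)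
    (hg_lsc.comp (hv.continuous hZ hφ hg hu)).measurable
    (fun _ _ => hv.toReal_le hZ hφ hu) (fun _ _ => hv.lintegral_sq_le hZ hφ hg hu)
    fun _ _ => hv.edist_le_lintegral hZ hφ hg hu

theorem IsReduction.succ (hv : IsReduction φ g u Z w v) (hZ : IsActiveTime g u Z) : Succ u v := by
  refine ⟨?_, fun t => (Z t).toNNReal, ?_, ?_, by simp [hZ.zero],
    fun t => (hv.apply_activeTime t).symm⟩
  · rintro _ ⟨r, rfl⟩
    by_cases hr : ∀ t : ℝ≥0, Z t ≠ r
    · obtain ⟨hvr, hlim, -⟩ := hv.off_range r hr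
      exact Or.inr ⟨fun n => n, tendsto_natCast_atTop_atTop,
        hvr ▸ hlim.comp tendsto_natCast_atTop_atTop⟩
    · push Not at hr
      obtain ⟨t, ht⟩ := hr
      refine Or.inl ⟨t, ?_⟩
      rw [← hv.apply_activeTime t, ht, Real.toNNReal_coe]
  · exact fun a b hab => Real.toNNReal_mono (hZ.mono hab)
  · have := Real.lipschitzWith_toNNReal.comp (hZ.lipschitz.comp NNReal.isometry_coe.lipschitz)
    rwa [mul_one, mul_one] at this

/-- The reduction spends no time in `{g = 0}` as long as its time is reached by `Z`, and it is at
rest afterwards. -/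
theorem IsReduction.volume_eq_zero (hv : IsReduction φ g u Z w v) (hZ : IsActiveTime g u Z)
    (hgm : Measurable fun r => g (v r)) :
    volume {t : ℝ | 0 ≤ t ∧ ENNReal.ofReal t < Tstar v ∧ g (v t.toNNReal) = 0} = 0 := by
  set K : Set ℝ := {r | g (v r.toNNReal) = 0} with hK
  have hKm : MeasurableSet K :=
    (measurableSet_singleton (0 : ℝ≥0∞)).preimage (hgm.comp measurable_real_toNNReal)
  have hsub : {t : ℝ | 0 ≤ t ∧ ENNReal.ofReal t < Tstar v ∧ g (v t.toNNReal) = 0} ⊆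
      ⋃ n : ℕ, K ∩ Set.Icc (Z (0 : ℝ≥0)) (Z (n : ℝ≥0)) := by
    rintro t ⟨h0, hlt, hgt⟩
    lift t to ℝ≥0 using h0
    have hmem : ∃ b : ℝ≥0, Z b = t := by
      by_contra! hne
      -- Beyond the range of `Z` the curve rests at `w`, so `T⋆(v) ≤ t`.
      have hconst : ∀ r : ℝ≥0, t ≤ r → v r = w := fun r hr => (hv.off_range r fun a =>
        ((hZ.lt_of_notMem_range hne a).trans_le (by exact_mod_cast hr)).ne).1
      rw [ENNReal.ofReal_coe_nnreal] at hlt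
      refine absurd hlt (not_lt.2 (sInf_le ⟨t, rfl, fun r hr => ?_⟩))
      rw [hconst r hr, hconst t le_rfl]
    obtain ⟨b, hb⟩ := hmem
    obtain ⟨n, hn⟩ := exists_nat_ge b
    refine Set.mem_iUnion.2 ⟨n, hgt, ?_, ?_⟩
    · rw [NNReal.coe_zero, hZ.zero]; exact t.2
    · rw [← hb]; exact hZ.mono (NNReal.coe_le_coe.2 hn)
  refine measure_mono_null hsub (measure_iUnion_null fun n => ?_)
  have h := hv.lintegral_Icc_eq hZ ({x | g x = 0}.indicator 1) (zero_le (a := (n : ℝ≥0)))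
  rw [← Measure.restrict_apply hKm, ← lintegral_indicator_one hKm]
  refine h.trans ?_
  rw [lintegral_congr (g := fun _ => 0) fun r => ?_, lintegral_zero]
  by_cases hr : g (u r.toNNReal) = 0 <;> simp [hr]

end MinimalGradientFlow

theorem mainTheorem8 {S : Type*} [MetricSpace S] [CompleteSpace S]
    (φ : S → EReal) (g : S → ℝ≥0∞)
    (hφ_bot : ∀ x, φ x ≠ ⊥)
    (hφ_lsc : LowerSemicontinuous φ) (hg_lsc : LowerSemicontinuous g)
    (hφ_quad : ∃ A B : ℝ, 0 < A ∧ 0 < B ∧ ∃ x₀ : S, ∀ x : S,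
      ((-A - B * dist x x₀ ^ 2 : ℝ) : EReal) ≤ φ x)
    (hg_sug : MinimalGradientFlow.IsStrongUpperGradient φ g)
    (u : ℝ≥0 → S) (hu : u ∈ MinimalGradientFlow.solutions φ g) :
    MinimalGradientFlow.IsMinimal (MinimalGradientFlow.solutions φ g) u ↔
      volume {t : ℝ | 0 ≤ t ∧ ENNReal.ofReal t < MinimalGradientFlow.Tstar u ∧
        g (u t.toNNReal) = 0} = 0 := by
  refine ⟨fun hmin => ?_, MinimalGradientFlow.isMinimal_of_volume_eq_zero hφ_bot hg_sug hu⟩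
  obtain ⟨Z, hZ⟩ := MinimalGradientFlow.exists_isActiveTime hu.2.1
  obtain ⟨w, v, hv⟩ :=
    MinimalGradientFlow.exists_isReduction hZ hφ_bot hφ_lsc hg_lsc hφ_quad hg_sug hu
  have hvU := hv.mem_solutions hZ hφ_bot hg_lsc hg_sug hu
  rw [hmin.2 v hvU (hv.succ hZ)]
  exact hv.volume_eq_zero hZ hvU.2.1
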